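/- **Theorem.** The trace norm $\|A\|_*$ of a real matrix $A$ is the sum of its singular values, i.e. of the square roots of the eigenvalues of $AA^{T}$ counted with multiplicity. Call two matrices (possibly of different sizes) equivalent if they can be obtained from each other by a finite sequence of the following operations: transpositions; permutations of rows or of columns; insertions or deletions of zero rows or zero columns. Let $J_{a,b}$ and $0_{a,b}$ denote the all-ones and the all-zeros matrix of size $a\times b$. Let $A$ be a $(0,1)$-matrix (of any size) with exactly $m$ entries equal to $1$. If $$\sqrt{m}<\|A\|_*<\sqrt{m-1}+1,$$ then there are integers $s,r,p\ge 1$ such that $A$ is equivalent to the block matrix $$\begin{bmatrix} J_{s,p} & J_{s,1}\\ J_{r,p} & 0_{r,1}\end{bmatrix}.$$ -/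

import Mathlib

open scoped Matrix

/-- The trace norm of a matrix `A`: the sum of its singular values, which are the square roots of
the eigenvalues (with multiplicity) of the positive semidefinite matrix `A Aᴴ`. -/
noncomputable def Matrix.traceNorm {𝕜 : Type*} [RCLike 𝕜] {ι κ : Type*} [Fintype ι] [DecidableEq ι]
    [Fintype κ] (A : Matrix ι κ 𝕜) : ℝ :=
  ∑ i, Real.sqrt ((Matrix.isHermitian_mul_conjTranspose_self A).eigenvalues i)

/-- Two matrices, possibly of different sizes, are equivalent if they can be obtained from each
other by a finite sequence of transpositions, permutations of rows or of columns, and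
insertions or deletions of zero rows or zero columns. (The insertion of a zero line is the
inverse of a deletion, provided by `symm`.) -/
inductive Matrix.Equivalent {α : Type*} [Zero α] : {a b c d : ℕ} →
    Matrix (Fin a) (Fin b) α → Matrix (Fin c) (Fin d) α → Prop
  | refl {a b : ℕ} (A : Matrix (Fin a) (Fin b) α) : Matrix.Equivalent A A
  | symm {a b c d : ℕ} {A : Matrix (Fin a) (Fin b) α} {B : Matrix (Fin c) (Fin d) α} :
      Matrix.Equivalent A B → Matrix.Equivalent B A
  | trans {a b c d e f : ℕ} {A : Matrix (Fin a) (Fin b) α} {B : Matrix (Fin c) (Fin d) α}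
      {C : Matrix (Fin e) (Fin f) α} :
      Matrix.Equivalent A B → Matrix.Equivalent B C → Matrix.Equivalent A C
  | transpose {a b : ℕ} (A : Matrix (Fin a) (Fin b) α) : Matrix.Equivalent A Aᵀ
  | permRows {a b : ℕ} (A : Matrix (Fin a) (Fin b) α) (σ : Equiv.Perm (Fin a)) :
      Matrix.Equivalent A (A.submatrix σ id)
  | permCols {a b : ℕ} (A : Matrix (Fin a) (Fin b) α) (σ : Equiv.Perm (Fin b)) :
      Matrix.Equivalent A (A.submatrix id σ)
  | deleteZeroRow {a b : ℕ} (A : Matrix (Fin (a + 1)) (Fin b) α) (i : Fin (a + 1))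
      (h : ∀ j, A i j = 0) : Matrix.Equivalent A (A.submatrix i.succAbove id)
  | deleteZeroCol {a b : ℕ} (A : Matrix (Fin a) (Fin (b + 1)) α) (j : Fin (b + 1))
      (h : ∀ i, A i j = 0) : Matrix.Equivalent A (A.submatrix id j.succAbove)

/-- The all-ones matrix `J_{p,q}`. -/
def Matrix.allOnes (p q : ℕ) : Matrix (Fin p) (Fin q) ℝ := Matrix.of fun _ _ => 1

/-- The `(s + r) × (p + 1)` block matrix with block rows `J_{s,p}, J_{s,1}` and
`J_{r,p}, 0_{r,1}`. -/
def Matrix.cornerBlock (s r p : ℕ) : Matrix (Fin (s + r)) (Fin (p + 1)) ℝ :=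
  Matrix.reindex finSumFinEquiv finSumFinEquiv
    (Matrix.fromBlocks (Matrix.allOnes s p) (Matrix.allOnes s 1) (Matrix.allOnes r p) 0)

/-! Let `s i` be the singular values, so `∑ s i ^ 2 = m`, and put `X = ‖A‖_*² - m`, the sum of `s i
* s k` over `i ≠ k`. The same sum for the squares is `m² - tr (AAᵀ)²`, which is `crossSum` and thus
counts nonzero minors. Since `2 * crossSum ≤ X²` (`two_mul_crossSum_le`) and the upper bound says `X
< 2√(m-1)`, it follows that `crossSum < 2(m-1)`; the lower bound gives `crossSum > 0`.

The rest is combinatorial: without zero lines, at least two non-full rows and two non-full columns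
force `crossSum ≥ 2(m-1)` (`two_mul_entrySum_le_crossSum`). Indeed `crossSum` is the degree sum of
`conflictGraph` on the `m` ones. If this graph is connected it has at least `m-1` edges; otherwise
`A` has a full row and a full column, and a block count suffices. So exactly one row or column is
non-full, which is the block form up to transposition. -/

/-- The sum over all `2 × 2` submatrices `[x, y; z, w]`, with ordered rows and ordered columns, of
`x * w * (1 - y * z)`. For a `(0,1)`-matrix it is twice the number of nonzero `2 × 2` minors. -/
def Matrix.crossSum {ι κ : Type*} [Fintype ι] [Fintype κ] (A : Matrix ι κ ℝ) : ℝ :=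
  ∑ i, ∑ k, ∑ j, ∑ l, A i j * A k l * (1 - A i l * A k j)

/-- The sum of the entries of a matrix. -/
def Matrix.entrySum {ι κ : Type*} [Fintype ι] [Fintype κ] (A : Matrix ι κ ℝ) : ℝ :=
  ∑ i, ∑ j, A i j

/-! ### Singular values and the count of nonzero minors. -/

section Spectral

variable {ι κ : Type*} [Fintype ι] [Fintype κ] {A : Matrix ι κ ℝ}

theorem trace_mul_conjTranspose_self_eq_entrySum (h01 : ∀ i j, A i j = 0 ∨ A i j = 1) :
    (A * Aᴴ).trace = A.entrySum := by
  simp only [Matrix.trace, Matrix.diag, Matrix.mul_apply, Matrix.entrySum,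
    Matrix.conjTranspose_apply, star_trivial]
  refine Finset.sum_congr rfl fun i _ => Finset.sum_congr rfl fun j _ => ?_
  rcases h01 i j with h | h <;> simp [h]

theorem entrySum_sq_sub_trace_sq (A : Matrix ι κ ℝ) :
    A.entrySum ^ 2 - ((A * Aᴴ) * (A * Aᴴ)).trace = A.crossSum := by
  have h1 : ((A * Aᴴ) * (A * Aᴴ)).trace =
      ∑ i, ∑ k, ∑ j, ∑ l, A i j * A k l * (A i l * A k j) := by
    simp only [Matrix.trace, Matrix.diag, Matrix.mul_apply, Matrix.conjTranspose_apply,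
      star_trivial, Finset.sum_mul_sum]
    refine Finset.sum_congr rfl fun i _ => Finset.sum_congr rfl fun k _ =>
      Finset.sum_congr rfl fun j _ => Finset.sum_congr rfl fun l _ => ?_
    ring
  have h2 : A.entrySum ^ 2 = ∑ i, ∑ k, ∑ j, ∑ l, A i j * A k l := by
    rw [Matrix.entrySum, sq, Finset.sum_mul_sum]
    simp only [Finset.sum_mul_sum]
  rw [h1, h2, Matrix.crossSum]
  simp only [← Finset.sum_sub_distrib]
  refine Finset.sum_congr rfl fun i _ => Finset.sum_congr rfl fun k _ =>
      Finset.sum_congr rfl fun j _ => Finset.sum_congr rfl fun l _ => ?_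
  ring

variable [DecidableEq ι]

theorem sum_offDiag_mul (s : ι → ℝ) :
    ∑ i, ∑ k, (if i = k then 0 else s i * s k) = (∑ i, s i) ^ 2 - ∑ i, s i ^ 2 := by
  have h : ∀ i k, (if i = k then 0 else s i * s k) =
      s i * s k - if i = k then s i * s k else 0 := by
    intro i k; split_ifs <;> simp
  simp_rw [h, Finset.sum_sub_distrib, sq, Finset.sum_mul_sum]
  simp

/-- The off-diagonal part of the square of a sum of nonnegative numbers dominates the off-diagonal
part of the square of the sum of their squares. -/
theorem two_mul_sq_sum_sq_sub_le (s : ι → ℝ) (hs : ∀ i, 0 ≤ s i) :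
    2 * ((∑ i, s i ^ 2) ^ 2 - ∑ i, s i ^ 4) ≤ ((∑ i, s i) ^ 2 - ∑ i, s i ^ 2) ^ 2 := by
  set y : ι → ι → ℝ := fun i k => if i = k then 0 else s i * s k with hy
  have hy0 : ∀ i k, 0 ≤ y i k := by
    intro i k
    simp only [hy]
    split_ifs
    · rfl
    · exact mul_nonneg (hs i) (hs k)
  have hsymm : ∀ i k, y i k = y k i := by
    intro i k
    simp only [hy, eq_comm (a := i), mul_comm (s i)]
  have hsq : (∑ i, s i ^ 2) ^ 2 - ∑ i, s i ^ 4 = ∑ i, ∑ k, y i k ^ 2 := by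
    have := sum_offDiag_mul (fun i => s i ^ 2)
    simp only [← pow_mul] at this
    rw [← this]
    refine Finset.sum_congr rfl fun i _ => Finset.sum_congr rfl fun k _ => ?_
    simp only [hy]
    split_ifs <;> ring
  rw [hsq, ← sum_offDiag_mul, sq, Finset.sum_mul, Finset.mul_sum]
  refine Finset.sum_le_sum fun i _ => ?_
  rw [Finset.sum_mul, Finset.mul_sum]
  refine Finset.sum_le_sum fun k _ => ?_
  change 2 * y i k ^ 2 ≤ y i k * ∑ i, ∑ k, y i k
  by_cases hik : i = k
  · simp [hy, hik]
  -- The entries at `(i, k)` and `(k, i)` are distinct and equal, so each is at most half the total;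
  -- this gives the factor 2.
  have hle : y i k + y k i ≤ ∑ i, ∑ k, y i k := by
    have h1 : ∀ i k, y i k ≤ ∑ k, y i k := fun i k =>
      Finset.single_le_sum (fun k _ => hy0 i k) (Finset.mem_univ k)
    calc y i k + y k i ≤ ∑ k, y i k + ∑ i, y k i := add_le_add (h1 i k) (h1 k i)
      _ = ∑ j ∈ {i, k}, ∑ l, y j l := by rw [Finset.sum_pair hik]
      _ ≤ _ := Finset.sum_le_sum_of_subset_of_nonneg (Finset.subset_univ _)
          fun j _ _ => Finset.sum_nonneg fun l _ => hy0 j l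
  rw [← hsymm i k] at hle
  nlinarith [hy0 i k]

/-- A nonzero off-diagonal sum yields two distinct indices with nonzero values, whose squares
contribute positively. -/
theorem sq_sum_sq_sub_pos (s : ι → ℝ) (h : (∑ i, s i) ^ 2 - ∑ i, s i ^ 2 ≠ 0) :
    0 < (∑ i, s i ^ 2) ^ 2 - ∑ i, s i ^ 4 := by
  rw [← sum_offDiag_mul] at h
  obtain ⟨i, -, hi⟩ := Finset.exists_ne_zero_of_sum_ne_zero h
  obtain ⟨k, -, hk⟩ := Finset.exists_ne_zero_of_sum_ne_zero hi
  have := sum_offDiag_mul (fun i => s i ^ 2)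
  simp only [← pow_mul] at this
  rw [← this]
  have h0 : ∀ i k, 0 ≤ (if i = k then 0 else s i ^ 2 * s k ^ 2) := by
    intro i k
    split_ifs
    · rfl
    · positivity
  refine Finset.sum_pos' (fun i _ => Finset.sum_nonneg fun k _ => h0 i k)
    ⟨i, Finset.mem_univ i, Finset.sum_pos' (fun k _ => h0 i k) ⟨k, Finset.mem_univ k, ?_⟩⟩
  split_ifs at hk ⊢ with hik
  · exact absurd rfl hk
  · rw [← mul_pow]; positivity

theorem Matrix.IsHermitian.trace_mul_self_eq_sum_eigenvalues_sq {M : Matrix ι ι ℝ}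
    (hM : M.IsHermitian) : (M * M).trace = ∑ i, hM.eigenvalues i ^ 2 := by
  conv_lhs => rw [hM.spectral_theorem, ← map_mul, Unitary.conjStarAlgAut_apply,
    Matrix.trace_mul_comm, ← mul_assoc]
  simp [Matrix.trace, sq]

theorem sum_sq_singularValues (h01 : ∀ i j, A i j = 0 ∨ A i j = 1) :
    ∑ i, Real.sqrt ((Matrix.isHermitian_mul_conjTranspose_self A).eigenvalues i) ^ 2 =
      A.entrySum := by
  rw [← trace_mul_conjTranspose_self_eq_entrySum h01,
    (Matrix.isHermitian_mul_conjTranspose_self A).trace_eq_sum_eigenvalues]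
  exact Finset.sum_congr rfl fun i _ =>
    Real.sq_sqrt ((Matrix.posSemidef_self_mul_conjTranspose A).eigenvalues_nonneg i)

theorem crossSum_eq_singularValues (h01 : ∀ i j, A i j = 0 ∨ A i j = 1) :
    (∑ i, Real.sqrt ((Matrix.isHermitian_mul_conjTranspose_self A).eigenvalues i) ^ 2) ^ 2 -
      ∑ i, Real.sqrt ((Matrix.isHermitian_mul_conjTranspose_self A).eigenvalues i) ^ 4 =
      A.crossSum := by
  rw [sum_sq_singularValues h01, ← entrySum_sq_sub_trace_sq A,
    (Matrix.isHermitian_mul_conjTranspose_self A).trace_mul_self_eq_sum_eigenvalues_sq]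
  congr 1
  refine Finset.sum_congr rfl fun i _ => ?_
  rw [show 4 = 2 * 2 from rfl, pow_mul,
    Real.sq_sqrt ((Matrix.posSemidef_self_mul_conjTranspose A).eigenvalues_nonneg i)]

theorem two_mul_crossSum_le (h01 : ∀ i j, A i j = 0 ∨ A i j = 1) :
    2 * A.crossSum ≤ (A.traceNorm ^ 2 - A.entrySum) ^ 2 := by
  rw [← crossSum_eq_singularValues h01, ← sum_sq_singularValues h01]
  exact two_mul_sq_sum_sq_sub_le _ fun i => Real.sqrt_nonneg _

theorem crossSum_pos (h01 : ∀ i j, A i j = 0 ∨ A i j = 1)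
    (h : A.traceNorm ^ 2 - A.entrySum ≠ 0) : 0 < A.crossSum := by
  rw [← crossSum_eq_singularValues h01]
  rw [← sum_sq_singularValues h01] at h
  exact sq_sum_sq_sub_pos _ h

/-- Squaring `hupp` gives `X < 2√(m-1)` for `X = ‖A‖_*² - m`, while `hlow` gives `X > 0`, so that
`X² < 4(m-1)`. -/
theorem crossSum_lt (h01 : ∀ i j, A i j = 0 ∨ A i j = 1) (h1 : 1 ≤ A.entrySum)
    (hlow : Real.sqrt A.entrySum < A.traceNorm)
    (hupp : A.traceNorm < Real.sqrt (A.entrySum - 1) + 1) :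
    A.crossSum < 2 * (A.entrySum - 1) := by
  have h := two_mul_crossSum_le h01
  have hs := Real.sq_sqrt (sub_nonneg.2 h1)
  have hm := Real.sq_sqrt (zero_le_one.trans h1)
  have := Real.sqrt_nonneg (A.entrySum - 1)
  have := Real.sqrt_nonneg A.entrySum
  have hX0 : 0 < A.traceNorm ^ 2 - A.entrySum := by nlinarith
  have hX : A.traceNorm ^ 2 - A.entrySum < 2 * Real.sqrt (A.entrySum - 1) := by nlinarith
  nlinarith

end Spectral

theorem entrySum_eq_ncard {ι κ : Type*} [Fintype ι] [Fintype κ] {A : Matrix ι κ ℝ}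
    (h01 : ∀ i j, A i j = 0 ∨ A i j = 1) :
    A.entrySum = ({ij : ι × κ | A ij.1 ij.2 = 1}.ncard : ℝ) := by
  classical
  rw [Set.ncard_eq_toFinset_card', Set.toFinset_ofPred, Finset.natCast_card_filter,
    Fintype.sum_prod_type, Matrix.entrySum]
  refine Finset.sum_congr rfl fun i _ => Finset.sum_congr rfl fun j _ => ?_
  rcases h01 i j with h | h <;> simp [h]

/-! ### Counting minors when a full row and a full column exist. -/

section Counting

variable {S R P C : Type*} [Fintype S] [Fintype R] [Fintype P] [Fintype C]
  {A : Matrix (S ⊕ R) (P ⊕ C) ℝ}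

theorem entrySum_sum (hS : ∀ i j, A (Sum.inl i) j = 1) (hP : ∀ i j, A i (Sum.inl j) = 1) :
    A.entrySum = Fintype.card S * Fintype.card P + Fintype.card S * Fintype.card C
        + Fintype.card R * Fintype.card P + ∑ k, ∑ l, A (Sum.inr k) (Sum.inr l) := by
  simp [Matrix.entrySum, Finset.sum_add_distrib, hS, hP]
  ring

/-- The pairs of ones are sorted by block. Ones in `S × P` conflict with nothing; the terms come
from `S × C` against `R × P`, `S × C` against `B`, `R × P` against `B`, and pairs inside `B`. -/
theorem crossSum_sum (hS : ∀ i j, A (Sum.inl i) j = 1) (hP : ∀ i j, A i (Sum.inl j) = 1)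
    (B : R → C → ℝ) (hB : ∀ k l, A (Sum.inr k) (Sum.inr l) = B k l) :
    A.crossSum =
      2 * Fintype.card S * (Fintype.card P * ∑ k, ∑ j, (1 - B k j)
        + ∑ k, ∑ j, ∑ l, B k l * (1 - B k j))
      + 2 * Fintype.card P * ∑ l, ∑ i, ∑ k, B i l * (1 - B k l)
      + ∑ i, ∑ k, ∑ j, ∑ l, B i j * B k l * (1 - B i l * B k j) := by
  have e1 : ∑ i, ∑ k, ∑ l, B k l * (1 - B i l) = ∑ l, ∑ i, ∑ k, B i l * (1 - B k l) := by
    rw [Finset.sum_congr rfl fun i _ => Finset.sum_comm, Finset.sum_comm]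
    exact Finset.sum_congr rfl fun i _ => Finset.sum_comm
  have e2 : ∑ i, ∑ k, ∑ l, B i l * (1 - B k l) = ∑ l, ∑ i, ∑ k, B i l * (1 - B k l) := by
    rw [Finset.sum_congr rfl fun i _ => Finset.sum_comm, Finset.sum_comm]
  have e3 : ∑ i, ∑ j, B i j * ∑ l, (1 - B i l) = ∑ i, ∑ j, ∑ l, B i l * (1 - B i j) := by
    simp_rw [Finset.mul_sum]
    exact Finset.sum_congr rfl fun i _ => Finset.sum_comm
  simp only [Matrix.crossSum, Fintype.sum_sum_type, hS, hP, hB, mul_one, one_mul, sub_self,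
    Finset.sum_const_zero, mul_zero, zero_add, Finset.sum_add_distrib, Finset.sum_const,
    Finset.card_univ, nsmul_eq_mul, ← Finset.mul_sum, e1, e2, e3]
  ring

theorem two_mul_entrySum_le_crossSum_sum [Nonempty S] [Nonempty P]
    (hS : ∀ i j, A (Sum.inl i) j = 1) (hP : ∀ i j, A i (Sum.inl j) = 1)
    (h01 : ∀ i j, A i j = 0 ∨ A i j = 1)
    (hR : ∀ i, ∃ j, A (Sum.inr i) j = 0) (hC : ∀ j, ∃ i, A i (Sum.inr j) = 0)
    (hRc : 2 ≤ Fintype.card R) (hCc : 2 ≤ Fintype.card C) :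
    2 * (A.entrySum - 1) ≤ A.crossSum := by
  set B : R → C → ℝ := fun k l => A (Sum.inr k) (Sum.inr l) with hB
  have hB0 : ∀ k l, 0 ≤ B k l := fun k l => by
    rcases h01 (.inr k) (.inr l) with h | h <;> simp [hB, h]
  have hB1 : ∀ k l, B k l ≤ 1 := fun k l => by
    rcases h01 (.inr k) (.inr l) with h | h <;> simp [hB, h]
  have hz0 : ∀ k l, 0 ≤ 1 - B k l := fun k l => sub_nonneg.2 (hB1 k l)
  have hR' : ∀ k, ∃ l, B k l = 0 := by
    intro k
    obtain ⟨j | j, hj⟩ := hR k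
    · simp [hP] at hj
    · exact ⟨j, hj⟩
  have hC' : ∀ l, ∃ k, B k l = 0 := by
    intro l
    obtain ⟨j | j, hj⟩ := hC l
    · simp [hS] at hj
    · exact ⟨j, hj⟩
  set t := ∑ k, ∑ l, B k l with ht
  -- Every row of `B` contains a zero, so each one of `B` can be paired with a zero of its row; `h2`
  -- does the same for columns.
  have h1 : t ≤ ∑ k, ∑ j, ∑ l, B k l * (1 - B k j) := by
    refine Finset.sum_le_sum fun k _ => ?_
    obtain ⟨j, hj⟩ := hR' k
    refine le_trans (le_of_eq ?_) (Finset.single_le_sum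
      (fun j _ => Finset.sum_nonneg fun l _ => mul_nonneg (hB0 k l) (hz0 k j)) (Finset.mem_univ j))
    simp [hj]
  have h2 : t ≤ ∑ l, ∑ i, ∑ k, B i l * (1 - B k l) := by
    rw [ht, Finset.sum_comm]
    refine Finset.sum_le_sum fun l _ => Finset.sum_le_sum fun i _ => ?_
    obtain ⟨k, hk⟩ := hC' l
    refine le_trans (le_of_eq ?_) (Finset.single_le_sum
      (fun k _ => mul_nonneg (hB0 i l) (hz0 k l)) (Finset.mem_univ k))
    simp [hk]
  have h3 : 0 ≤ ∑ i, ∑ k, ∑ j, ∑ l, B i j * B k l * (1 - B i l * B k j) :=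
    Finset.sum_nonneg fun i _ => Finset.sum_nonneg fun k _ => Finset.sum_nonneg fun j _ =>
      Finset.sum_nonneg fun l _ => mul_nonneg (mul_nonneg (hB0 i j) (hB0 k l))
        (sub_nonneg.2 (mul_le_one₀ (hB1 i l) (hB0 k j) (hB1 k j)))
  have hz : ∑ k, ∑ j, (1 - B k j) = Fintype.card R * Fintype.card C - t := by
    simp [Finset.sum_sub_distrib, ht]
  have hz1 : 1 ≤ ∑ k, ∑ j, (1 - B k j) := by
    obtain ⟨k⟩ : Nonempty R := Fintype.card_pos_iff.1 (by omega)
    obtain ⟨j, hj⟩ := hR' k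
    calc (1 : ℝ) = 1 - B k j := by simp [hj]
      _ ≤ ∑ j, (1 - B k j) :=
        Finset.single_le_sum (fun j _ => hz0 k j) (Finset.mem_univ j)
      _ ≤ _ := Finset.single_le_sum (f := fun k => ∑ j, (1 - B k j))
        (fun k _ => Finset.sum_nonneg fun j _ => hz0 k j) (Finset.mem_univ k)
  rw [entrySum_sum hS hP, crossSum_sum hS hP B fun _ _ => rfl]
  change 2 * (_ + t - 1) ≤ _
  set z := ∑ k, ∑ j, (1 - B k j)
  have hs : (1 : ℝ) ≤ Fintype.card S := by exact_mod_cast Fintype.card_pos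
  have hp : (1 : ℝ) ≤ Fintype.card P := by exact_mod_cast Fintype.card_pos
  have hr : (2 : ℝ) ≤ Fintype.card R := by exact_mod_cast hRc
  have hq : (2 : ℝ) ≤ Fintype.card C := by exact_mod_cast hCc
  -- With `|S| = 1 + x`, `|P| = 1 + y` and `t + z = r * q`, half the difference of the two sides is
  -- at least `(rq-q-r) + x(rq-q-1) + y(rq-r-1) + xy(z-1)`, whose terms are nonnegative for `r, q ≥
  -- 2`.
  obtain ⟨x, hx⟩ : ∃ x : ℝ, x = Fintype.card S - 1 := ⟨_, rfl⟩
  obtain ⟨y, hy⟩ : ∃ y : ℝ, y = Fintype.card P - 1 := ⟨_, rfl⟩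
  rw [show (Fintype.card S : ℝ) = 1 + x by linarith, show (Fintype.card P : ℝ) = 1 + y by linarith]
  have hx0 : 0 ≤ x := by linarith
  have hy0 : 0 ≤ y := by linarith
  generalize (Fintype.card R : ℝ) = r at *
  generalize (Fintype.card C : ℝ) = q at *
  have hq1 : 0 ≤ r * q - q - r := by nlinarith
  have k1 := mul_nonneg hx0 (show 0 ≤ r * q - q - 1 by linarith)
  have k2 := mul_nonneg hy0 (show 0 ≤ r * q - r - 1 by linarith)
  have k3 := mul_nonneg (mul_nonneg hx0 hy0) (sub_nonneg.2 hz1)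
  have k4 := mul_le_mul_of_nonneg_left h1 (show 0 ≤ 1 + x by linarith)
  have k5 := mul_le_mul_of_nonneg_left h2 (show 0 ≤ 1 + y by linarith)
  have htz : t = r * q - z := by linarith
  rw [htz] at k4 k5 ⊢
  linarith

end Counting

/-! ### Connectivity of the conflict graph. -/

section ConflictGraph

variable {ι κ : Type*}

/-- The graph on the ones of a matrix where two ones are adjacent if they are the diagonal of a
`2 × 2` submatrix with a zero on its other diagonal. -/
def conflictGraph (A : Matrix ι κ ℝ) : SimpleGraph {e : ι × κ // A e.1 e.2 = 1} where
  Adj e f := A e.1.1 f.1.2 = 0 ∨ A f.1.1 e.1.2 = 0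
  symm := ⟨fun _ _ h => h.symm⟩
  loopless := ⟨fun e h => by rcases h with h | h <;> simp [e.2] at h⟩

/-- Nonadjacent ones span an all-ones `2 × 2` submatrix, so a component and its complement fill each
other's crossings. A zero at `(i₀, j₀)` then forces the ones of row `i₀` and of column `j₀` into a
common class, and any one of the opposite class lies in a full row and a full column. -/
theorem conflictGraph_connected {A : Matrix ι κ ℝ} (h01 : ∀ i j, A i j = 0 ∨ A i j = 1)
    (hrow : ∀ i, ∃ j, A i j = 1) (hcol : ∀ j, ∃ i, A i j = 1)
    (hzero : ∃ i j, A i j = 0)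
    (hfull : ¬ ((∃ i, ∀ j, A i j = 1) ∧ ∃ j, ∀ i, A i j = 1)) :
    (conflictGraph A).Connected := by
  obtain ⟨i₀, j₀, h₀⟩ := hzero
  have : Nonempty {e : ι × κ // A e.1 e.2 = 1} := by
    obtain ⟨j, hj⟩ := hrow i₀
    exact ⟨⟨(i₀, j), hj⟩⟩
  refine ⟨fun e f => ?_⟩
  by_contra hef
  set X : {e : ι × κ // A e.1 e.2 = 1} → Prop := fun g => (conflictGraph A).Reachable e g with hX
  have key : ∀ g h, X g → ¬ X h → A g.1.1 h.1.2 = 1 ∧ A h.1.1 g.1.2 = 1 := by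
    intro g h hg hh
    have hadj : ¬ (conflictGraph A).Adj g h := fun hadj => hh (hg.trans hadj.reachable)
    simp only [conflictGraph, not_or] at hadj
    exact ⟨(h01 _ _).resolve_left hadj.1, (h01 _ _).resolve_left hadj.2⟩
  have hXe : X e := SimpleGraph.Reachable.refl e
  -- A line meeting both classes of ones is full.
  have rowfull : ∀ g h, X g → ¬ X h → g.1.1 = h.1.1 → ∀ j, A g.1.1 j = 1 := by
    intro g h hg hh hgh j
    obtain ⟨i, hi⟩ := hcol j
    by_cases hx : X ⟨(i, j), hi⟩
    · rw [hgh]; exact (key _ _ hx hh).2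
    · exact (key _ _ hg hx).1
  have colfull : ∀ g h, X g → ¬ X h → g.1.2 = h.1.2 → ∀ i, A i g.1.2 = 1 := by
    intro g h hg hh hgh i
    obtain ⟨j, hj⟩ := hrow i
    by_cases hx : X ⟨(i, j), hj⟩
    · rw [hgh]; exact (key _ _ hx hh).1
    · exact (key _ _ hg hx).2
  obtain ⟨j₁, hg⟩ := hrow i₀
  obtain ⟨i₁, hh⟩ := hcol j₀
  set g : {e : ι × κ // A e.1 e.2 = 1} := ⟨(i₀, j₁), hg⟩
  set h : {e : ι × κ // A e.1 e.2 = 1} := ⟨(i₁, j₀), hh⟩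
  have hne : ¬ A i₀ j₀ = 1 := by simp [h₀]
  by_cases Xg : X g <;> by_cases Xh : X h
  -- The one `f` lies in the other class. Its crossings with column `j₀` and row `i₀` are ones, and
  -- they belong to the class of `g` and `h`, as otherwise `key` would make `(i₀, j₀)` a one.
  · refine hfull ⟨⟨f.1.1, ?_⟩, ⟨f.1.2, ?_⟩⟩
    · by_cases Xw : X ⟨(f.1.1, j₀), (key h f Xh hef).2⟩
      · exact rowfull ⟨(f.1.1, j₀), (key h f Xh hef).2⟩ f Xw hef rfl
      · exact absurd (key _ _ Xg Xw).1 hne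
    · by_cases Xw : X ⟨(i₀, f.1.2), (key g f Xg hef).1⟩
      · exact colfull ⟨(i₀, f.1.2), (key g f Xg hef).1⟩ f Xw hef rfl
      · exact absurd (key _ _ Xh Xw).2 hne
  · exact hne (key _ _ Xg Xh).1
  · exact hne (key _ _ Xh Xg).2
  · refine hfull ⟨⟨e.1.1, ?_⟩, ⟨e.1.2, ?_⟩⟩
    · by_cases Xw : X ⟨(e.1.1, j₀), (key e h hXe Xh).1⟩
      · exact absurd (key _ _ Xw Xg).2 hne
      · exact rowfull e _ hXe Xw rfl
    · by_cases Xw : X ⟨(i₀, e.1.2), (key e g hXe Xg).2⟩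
      · exact absurd (key _ _ Xw Xh).1 hne
      · exact colfull e _ hXe Xw rfl

theorem sum_subtype_eq_one {α : Type*} [Fintype α] {w : α → ℝ} (hw : ∀ x, w x = 0 ∨ w x = 1)
    [Fintype {x // w x = 1}] (g : α → ℝ) : ∑ x : {x // w x = 1}, g x = ∑ x, w x * g x := by
  classical
  rw [← Finset.sum_subtype (Finset.univ.filter fun x => w x = 1) (by simp) g, Finset.sum_filter]
  refine Finset.sum_congr rfl fun x _ => ?_
  rcases hw x with h | h <;> simp [h]

/-- A connected graph on `m` vertices has at least `m - 1` edges, and `crossSum` is its degree sum.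
-/
theorem conflictGraph_bound [Fintype ι] [Fintype κ] {A : Matrix ι κ ℝ}
    (h01 : ∀ i j, A i j = 0 ∨ A i j = 1) (hA : (conflictGraph A).Connected) :
    2 * (A.entrySum - 1) ≤ A.crossSum := by
  classical
  have hw : ∀ x : ι × κ, A x.1 x.2 = 0 ∨ A x.1 x.2 = 1 := fun x => h01 _ _
  have h1 := hA.card_vert_le_card_edgeSet_add_one
  rw [Nat.card_eq_fintype_card, Nat.card_eq_fintype_card, ← SimpleGraph.edgeFinset_card] at h1
  have h2 := (conflictGraph A).sum_degrees_eq_twice_card_edges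
  have h3 : A.entrySum = Fintype.card {e : ι × κ // A e.1 e.2 = 1} := by
    have := sum_subtype_eq_one hw fun _ => 1
    simp only [mul_one, Finset.sum_const, Finset.card_univ, nsmul_eq_mul] at this
    rw [this, Matrix.entrySum, Fintype.sum_prod_type]
  have h4 : A.crossSum = ∑ e, ((conflictGraph A).degree e : ℝ) := by
    have hdeg : ∀ e, ((conflictGraph A).degree e : ℝ) =
        ∑ y : ι × κ, A y.1 y.2 * (1 - A e.1.1 y.2 * A y.1 e.1.2) := by
      intro e
      rw [← sum_subtype_eq_one hw fun y => 1 - A e.1.1 y.2 * A y.1 e.1.2,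
        ← SimpleGraph.card_neighborFinset_eq_degree, SimpleGraph.neighborFinset_eq_filter,
        Finset.natCast_card_filter]
      refine Finset.sum_congr rfl fun y _ => ?_
      simp only [conflictGraph]
      rcases h01 e.1.1 y.1.2 with h | h <;> rcases h01 y.1.1 e.1.2 with h' | h' <;> simp [h, h']
    simp_rw [hdeg]
    rw [sum_subtype_eq_one hw fun x =>
      ∑ y : ι × κ, A y.1 y.2 * (1 - A x.1 y.2 * A y.1 x.2)]
    simp only [Matrix.crossSum, Fintype.sum_prod_type, Finset.mul_sum, mul_assoc]
    exact Finset.sum_congr rfl fun i _ => Finset.sum_comm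
  have h5 : A.crossSum = 2 * ((conflictGraph A).edgeFinset.card : ℝ) := by
    rw [h4]; exact_mod_cast h2
  have h6 : (Fintype.card {e : ι × κ // A e.1 e.2 = 1} : ℝ) ≤
    (conflictGraph A).edgeFinset.card + 1 := by exact_mod_cast h1
  rw [h3, h5]
  linarith

end ConflictGraph

/-! ### Invariance under the equivalence operations. -/

section Invariance

variable {ι κ ι' κ' : Type*} [Fintype ι] [Fintype κ] [Fintype ι'] [Fintype κ']

theorem crossSum_transpose (A : Matrix ι κ ℝ) : Aᵀ.crossSum = A.crossSum := by
  simp only [Matrix.crossSum, Matrix.transpose_apply]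
  rw [Finset.sum_congr rfl fun j _ => Finset.sum_comm, Finset.sum_comm]
  refine Finset.sum_congr rfl fun i _ => ?_
  rw [Finset.sum_congr rfl fun j _ => Finset.sum_comm, Finset.sum_comm]
  refine Finset.sum_congr rfl fun k _ => Finset.sum_congr rfl fun j _ =>
    Finset.sum_congr rfl fun l _ => ?_
  ring

theorem entrySum_transpose (A : Matrix ι κ ℝ) : Aᵀ.entrySum = A.entrySum :=
  Finset.sum_comm

theorem crossSum_submatrix_equiv (A : Matrix ι κ ℝ) (e : ι' ≃ ι) (f : κ' ≃ κ) :
    (A.submatrix e f).crossSum = A.crossSum := by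
  simp only [Matrix.crossSum, Matrix.submatrix_apply]
  rw [← Equiv.sum_comp e]
  refine Finset.sum_congr rfl fun i _ => ?_
  rw [← Equiv.sum_comp e]
  refine Finset.sum_congr rfl fun k _ => ?_
  rw [← Equiv.sum_comp f]
  refine Finset.sum_congr rfl fun j _ => ?_
  rw [← Equiv.sum_comp f]

theorem entrySum_submatrix_equiv (A : Matrix ι κ ℝ) (e : ι' ≃ ι) (f : κ' ≃ κ) :
    (A.submatrix e f).entrySum = A.entrySum := by
  simp only [Matrix.entrySum, Matrix.submatrix_apply]
  rw [← Equiv.sum_comp e]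
  refine Finset.sum_congr rfl fun i _ => ?_
  rw [← Equiv.sum_comp f]

theorem crossSum_deleteZeroRow {a : ℕ} (A : Matrix (Fin (a + 1)) κ ℝ) (i : Fin (a + 1))
    (h : ∀ j, A i j = 0) : (A.submatrix i.succAbove id).crossSum = A.crossSum := by
  simp [Matrix.crossSum, Fin.sum_univ_succAbove _ i, h]

theorem entrySum_deleteZeroRow {a : ℕ} (A : Matrix (Fin (a + 1)) κ ℝ) (i : Fin (a + 1))
    (h : ∀ j, A i j = 0) : (A.submatrix i.succAbove id).entrySum = A.entrySum := by
  simp [Matrix.entrySum, Fin.sum_univ_succAbove _ i, h]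

end Invariance

/-! ### Reduction to the block form. -/

theorem Matrix.Equivalent.submatrix_equiv {α : Type*} [Zero α] {a b c d : ℕ}
    (A : Matrix (Fin a) (Fin b) α) (e : Fin c ≃ Fin a) (f : Fin d ≃ Fin b) :
    A.Equivalent (A.submatrix e f) := by
  obtain rfl : c = a := by simpa using Fintype.card_congr e
  obtain rfl : d = b := by simpa using Fintype.card_congr f
  exact (Matrix.Equivalent.permRows A e).trans (Matrix.Equivalent.permCols _ f)

/-- A `(0,1)`-matrix without zero lines in which all columns but one are full. -/
theorem equivalent_cornerBlock_of_card_eq_one {a b : ℕ} {A : Matrix (Fin a) (Fin b) ℝ}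
    (h01 : ∀ i j, A i j = 0 ∨ A i j = 1) (hrow : ∀ i, ∃ j, A i j = 1) (hcol : ∀ j, ∃ i, A i j = 1)
    (h : Nat.card {j // ¬ ∀ i, A i j = 1} = 1) :
    ∃ s r p : ℕ, 0 < s ∧ 0 < r ∧ 0 < p ∧ A.Equivalent (Matrix.cornerBlock s r p) := by
  classical
  rw [Nat.card_eq_fintype_card] at h
  obtain ⟨⟨j₀, hj₀⟩, huniq⟩ := Fintype.card_eq_one_iff.1 h
  have hfull : ∀ j, j ≠ j₀ → ∀ i, A i j = 1 := by
    intro j hj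
    by_contra hn
    exact hj (congrArg Subtype.val (huniq ⟨j, hn⟩))
  have hrowiff : ∀ i, (∀ j, A i j = 1) ↔ A i j₀ = 1 := fun i =>
    ⟨fun hi => hi j₀, fun hi j => by
      by_cases hj : j = j₀
      · rwa [hj]
      · exact hfull j hj i⟩
  obtain ⟨i₁, hi₁⟩ := hcol j₀
  obtain ⟨i₀, hi₀⟩ := not_forall.1 hj₀
  obtain ⟨j₁, hj₁⟩ := hrow i₀
  have hjne : j₁ ≠ j₀ := by rintro rfl; exact hi₀ hj₁
  -- Rows are sorted by their entry in column `j₀`, and `j₀` is moved to the last place.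
  let e : Fin (Fintype.card {i // A i j₀ = 1} + Fintype.card {i // ¬ A i j₀ = 1}) ≃ Fin a :=
    finSumFinEquiv.symm.trans (((Fintype.equivFin _).symm.sumCongr (Fintype.equivFin _).symm).trans
      (Equiv.sumCompl fun i => A i j₀ = 1))
  let u : Fin 1 ≃ {j // ¬ j ≠ j₀} :=
    (Equiv.ofUnique (Fin 1) {j // j = j₀}).trans (Equiv.subtypeEquivRight fun j => by simp)
  let f : Fin (Fintype.card {j // j ≠ j₀} + 1) ≃ Fin b :=
    finSumFinEquiv.symm.trans (((Fintype.equivFin _).symm.sumCongr u).trans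
      (Equiv.sumCompl fun j => j ≠ j₀))
  refine ⟨Fintype.card {i // A i j₀ = 1}, Fintype.card {i // ¬ A i j₀ = 1},
    Fintype.card {j // j ≠ j₀}, Fintype.card_pos_iff.2 ⟨⟨i₁, hi₁⟩⟩,
    Fintype.card_pos_iff.2 ⟨⟨i₀, hi₀⟩⟩, Fintype.card_pos_iff.2 ⟨⟨j₁, hjne⟩⟩, ?_⟩
  convert Matrix.Equivalent.submatrix_equiv A e f using 1
  ext i j
  obtain ⟨i, rfl⟩ := finSumFinEquiv.surjective i
  obtain ⟨j, rfl⟩ := finSumFinEquiv.surjective j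
  have hu : ∀ j, (u j : Fin b) = j₀ := fun j => not_not.1 (u j).2
  have hne : ∀ j, A ((Fintype.equivFin {i // ¬ A i j₀ = 1}).symm j) j₀ = 0 := fun j =>
    (h01 _ _).resolve_right ((Fintype.equivFin {i // ¬ A i j₀ = 1}).symm j).2
  have heq : ∀ j, A ((Fintype.equivFin {i // A i j₀ = 1}).symm j) j₀ = 1 := fun j =>
    ((Fintype.equivFin {i // A i j₀ = 1}).symm j).2
  have hf : ∀ i j, A i ((Fintype.equivFin {j // j ≠ j₀}).symm j) = 1 := fun i j =>
    hfull _ ((Fintype.equivFin {j // j ≠ j₀}).symm j).2 i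
  rcases i with i | i <;> rcases j with j | j <;>
    simp [Matrix.cornerBlock, Matrix.allOnes, e, f, hu, hne, heq, hf]

theorem two_mul_entrySum_le_crossSum {ι κ : Type*} [Fintype ι] [Fintype κ] {A : Matrix ι κ ℝ}
    (h01 : ∀ i j, A i j = 0 ∨ A i j = 1)
    (hrow : ∀ i, ∃ j, A i j = 1) (hcol : ∀ j, ∃ i, A i j = 1)
    (hr : 2 ≤ Nat.card {i // ¬ ∀ j, A i j = 1}) (hc : 2 ≤ Nat.card {j // ¬ ∀ i, A i j = 1}) :
    2 * (A.entrySum - 1) ≤ A.crossSum := by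
  classical
  rw [Nat.card_eq_fintype_card] at hr hc
  by_cases hfull : (∃ i, ∀ j, A i j = 1) ∧ ∃ j, ∀ i, A i j = 1
  · obtain ⟨⟨i₁, hi₁⟩, j₁, hj₁⟩ := hfull
    have : Nonempty {i // ∀ j, A i j = 1} := ⟨⟨i₁, hi₁⟩⟩
    have : Nonempty {j // ∀ i, A i j = 1} := ⟨⟨j₁, hj₁⟩⟩
    set e := Equiv.sumCompl fun i => ∀ j, A i j = 1
    set f := Equiv.sumCompl fun j => ∀ i, A i j = 1
    rw [← crossSum_submatrix_equiv A e f, ← entrySum_submatrix_equiv A e f]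
    refine two_mul_entrySum_le_crossSum_sum (fun i j => i.2 _) (fun i j => j.2 _)
      (fun i j => h01 _ _) (fun i => ?_) (fun j => ?_) hr hc
    · obtain ⟨j, hj⟩ := not_forall.1 i.2
      exact ⟨f.symm j, by simpa [e] using (h01 _ _).resolve_right hj⟩
    · obtain ⟨i, hi⟩ := not_forall.1 j.2
      exact ⟨e.symm i, by simpa [f] using (h01 _ _).resolve_right hi⟩
  · refine conflictGraph_bound h01 (conflictGraph_connected h01 hrow hcol ?_ hfull)
    obtain ⟨⟨i, hi⟩⟩ := Fintype.card_pos_iff.1 (zero_lt_two.trans_le hr)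
    obtain ⟨j, hj⟩ := not_forall.1 hi
    exact ⟨i, j, (h01 i j).resolve_right hj⟩

theorem equivalent_cornerBlock_of_crossSum_lt {n a b : ℕ} (hn : a + b = n)
    {A : Matrix (Fin a) (Fin b) ℝ} (h01 : ∀ i j, A i j = 0 ∨ A i j = 1)
    (hpos : 0 < A.crossSum) (hlt : A.crossSum < 2 * (A.entrySum - 1)) :
    ∃ s r p : ℕ, 0 < s ∧ 0 < r ∧ 0 < p ∧ A.Equivalent (Matrix.cornerBlock s r p) := by
  induction n using Nat.strong_induction_on generalizing a b with
  | _ n ih =>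
  -- `B` will be `A` or `Aᵀ`, so that deleting a zero row also handles zero columns.
  have delete : ∀ {c d : ℕ} {B : Matrix (Fin c) (Fin d) ℝ}, c + d = n → A.Equivalent B →
      (∀ i j, B i j = 0 ∨ B i j = 1) → B.crossSum = A.crossSum → B.entrySum = A.entrySum →
      (∃ i, ∀ j, B i j ≠ 1) →
      ∃ s r p : ℕ, 0 < s ∧ 0 < r ∧ 0 < p ∧ A.Equivalent (Matrix.cornerBlock s r p) := by
    rintro c d B hcd hAB hB hcross hentry ⟨i, hi⟩
    obtain _ | c := c
    · exact i.elim0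
    have hi0 : ∀ j, B i j = 0 := fun j => (hB i j).resolve_right (hi j)
    obtain ⟨s, r, p, hs, hr, hp, heq⟩ := ih (c + d) (by omega) rfl
      (A := B.submatrix i.succAbove id) (fun _ _ => hB _ _)
      (by rwa [crossSum_deleteZeroRow B i hi0, hcross])
      (by rwa [crossSum_deleteZeroRow B i hi0, entrySum_deleteZeroRow B i hi0, hcross, hentry])
    exact ⟨s, r, p, hs, hr, hp, (hAB.trans (.deleteZeroRow B i hi0)).trans heq⟩
  by_cases hrow : ∀ i, ∃ j, A i j = 1
  swap
  · push Not at hrow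
    exact delete hn (.refl A) h01 rfl rfl hrow
  by_cases hcol : ∀ j, ∃ i, A i j = 1
  swap
  · push Not at hcol
    exact delete (by omega) (.transpose A) (fun i j => h01 j i) (crossSum_transpose A)
      (entrySum_transpose A) hcol
  have hones : ¬ ∀ i j, A i j = 1 := fun h => by simp [Matrix.crossSum, h] at hpos
  obtain ⟨i₀, hi₀⟩ := not_forall.1 hones
  obtain ⟨j₀, hj₀⟩ := not_forall.1 hi₀
  have : Nonempty {i // ¬ ∀ j, A i j = 1} := ⟨⟨i₀, hi₀⟩⟩
  have : Nonempty {j // ¬ ∀ i, A i j = 1} := ⟨⟨j₀, fun h => hj₀ (h i₀)⟩⟩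
  have hr : 0 < Nat.card {i // ¬ ∀ j, A i j = 1} := Nat.card_pos
  have hc : 0 < Nat.card {j // ¬ ∀ i, A i j = 1} := Nat.card_pos
  by_cases hc1 : Nat.card {j // ¬ ∀ i, A i j = 1} = 1
  · exact equivalent_cornerBlock_of_card_eq_one h01 hrow hcol hc1
  by_cases hr1 : Nat.card {i // ¬ ∀ j, A i j = 1} = 1
  · obtain ⟨s, r, p, hs, hr, hp, heq⟩ := equivalent_cornerBlock_of_card_eq_one (A := Aᵀ)
      (fun i j => h01 j i) hcol hrow hr1
    exact ⟨s, r, p, hs, hr, hp, (Matrix.Equivalent.transpose A).trans heq⟩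
  exact absurd hlt (not_lt.2
    (two_mul_entrySum_le_crossSum h01 hrow hcol (by omega) (by omega)))

theorem mainTheorem4 (a b m : ℕ) (A : Matrix (Fin a) (Fin b) ℝ)
    (h01 : ∀ i j, A i j = 0 ∨ A i j = 1)
    (hm : {ij : Fin a × Fin b | A ij.1 ij.2 = 1}.ncard = m)
    (hlow : Real.sqrt (m : ℝ) < A.traceNorm)
    (hupp : A.traceNorm < Real.sqrt ((m : ℝ) - 1) + 1) :
    ∃ s r p : ℕ, 0 < s ∧ 0 < r ∧ 0 < p ∧ A.Equivalent (Matrix.cornerBlock s r p) := by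
  have hsum : A.entrySum = m := by rw [entrySum_eq_ncard h01, hm]
  have hX : A.traceNorm ^ 2 - A.entrySum ≠ 0 := by
    rw [hsum]
    have h0 := Real.sqrt_nonneg (m : ℝ)
    have := Real.sq_sqrt (Nat.cast_nonneg (α := ℝ) m)
    nlinarith
  have hpos := crossSum_pos h01 hX
  -- For `m = 0` the convention `√(-1) = 0` leaves `hupp` meaningful, so this case is excluded
  -- separately: a zero matrix has `crossSum` zero.
  have h1 : 1 ≤ A.entrySum := by
    rw [hsum]
    by_contra hlt
    obtain rfl : m = 0 := by
      have : ¬ 1 ≤ m := fun h => hlt (by exact_mod_cast h)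
      omega
    have hempty := (Set.ncard_eq_zero (Set.toFinite _)).1 hm
    have hA : ∀ i j, A i j = 0 := fun i j => (h01 i j).resolve_right fun h =>
      (Set.eq_empty_iff_forall_notMem.1 hempty (i, j)) h
    simp [Matrix.crossSum, hA] at hpos
  rw [← hsum] at hlow hupp
  exact equivalent_cornerBlock_of_crossSum_lt rfl h01 hpos (crossSum_lt h01 h1 hlow hupp)
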